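/- Let $\rho_{AB}$ be a two-qubit state (a positive semidefinite operator of trace one on $\mathbb C^2\otimes\mathbb C^2$) shared by Alice and Bob. Teleportation. In a standard teleportation protocol, Alice measures the input qubit together with $A$ in an orthonormal basis $|\Psi_1\rangle,\dots,|\Psi_4\rangle$ of maximally entangled two-qubit vectors, and Bob applies to $B$ a unitary $U_k\in U(2)$ that depends on her outcome $k$. Its fidelity is $$f=\int \langle\varphi|\Big(\sum_{k=1}^4 U_k\,\mathrm{Tr}_{\mathrm{in},A}\big[(|\Psi_k\rangle\langle\Psi_k|\otimes \mathbb 1_B)(|\varphi\rangle\langle\varphi|\otimes\rho_{AB})\big]U_k^\dagger\Big)|\varphi\rangle\,d\varphi ,$$ the average over pure input states $|\varphi\rangle$ distributed uniformly on the Bloch sphere. The state $\rho_{AB}$ is capable of non-classical teleportation fidelity if $f>\tfrac23$ for some such protocol. Bell-distinguishing (BD) game. Charlie sends, with probability $\tfrac12$ each, the halves of $|z\rangle_{A_pB_p}\in\{|\Phi^+\rangle,|\Psi^+\rangle\}$, where $|\Phi^+\rangle=\frac1{\sqrt2}(|00\rangle+|11\rangle)$ and $|\Psi^+\rangle=\frac1{\sqrt2}(|01\rangle+|10\rangle)$,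 to Alice and Bob. They apply controlled unitaries $U_{AA_p}=\mathbb 1\otimes|0\rangle\langle0|+U_A\otimes|1\rangle\langle1|$ and $V_{BB_p}=\mathbb 1\otimes|0\rangle\langle0|+V_B\otimes|1\rangle\langle1|$ with $U_A,V_B\in U(2)$, return $A_pB_p$, and guess $z$ by a joint measurement (POVM) $\{\Pi^{(z)}_{AB}\}_z$; Charlie projects $A_pB_p$ on $|z\rangle$. With $W=U_{AA_p}\otimes V_{BB_p}$, their winning probability is $$p_{\rm bd}(\rho_{AB})=\sum_z\tfrac12\,\mathrm{Tr}\big[(\Pi^{(z)}_{AB}\otimes|z\rangle\langle z|)\,W(\rho_{AB}\otimes|z\rangle\langle z|)W^\dagger\big].$$ The state $\rho_{AB}$ is capable of non-classical performance if $p_{\rm bd}(\rho_{AB})>\tfrac12$ for some choice of $U_A$, $V_B$ and $\{\Pi^{(z)}_{AB}\}$. Claim. Every two-qubit state that is capable of non-classical teleportation fidelity is capable of non-classical performance in the BD game. -/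

import Mathlib

open scoped Matrix Kronecker ComplexOrder

noncomputable section

/-- Index set of the computational basis of a qubit. -/
abbrev Qubit : Type := Fin 2

/-- Index set of the computational basis of two qubits. -/
abbrev TwoQubit : Type := Qubit × Qubit

/-- A density matrix of two qubits: positive semidefinite of trace one. -/
structure IsTwoQubitState (ρ : Matrix TwoQubit TwoQubit ℂ) : Prop where
  posSemidef : ρ.PosSemidef
  trace_eq_one : ρ.trace = 1

/-- The rank one operator `|v⟩⟨v|`. -/
def ketbra {ι : Type} (v : ι → ℂ) : Matrix ι ι ℂ := Matrix.vecMulVec v (star v)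

/-! ### The Bell-distinguishing game -/

/-- The Bell state `|Φ⁺⟩ = (|00⟩ + |11⟩)/√2`. -/
def bellPhi : TwoQubit → ℂ := fun p => if p.1 = p.2 then ((1 / √2 : ℝ) : ℂ) else 0

/-- The Bell state `|Ψ⁺⟩ = (|01⟩ + |10⟩)/√2`. -/
def bellPsi : TwoQubit → ℂ := fun p => if p.1 = p.2 then 0 else ((1 / √2 : ℝ) : ℂ)

/-- The two question states of the game: `|Φ⁺⟩` for `0` and `|Ψ⁺⟩` for `1`. -/
def question : Fin 2 → TwoQubit → ℂ := ![bellPhi, bellPsi]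

/-- A tactic of Alice and Bob: local unitaries `U_A`, `V_B` (applied under the control of the
question qubits they receive) and a joint two-outcome measurement (POVM) `Π^(z)` on `AB`. -/
structure BDTactic where
  U : Matrix.unitaryGroup Qubit ℂ
  V : Matrix.unitaryGroup Qubit ℂ
  meas : Fin 2 → Matrix TwoQubit TwoQubit ℂ
  meas_posSemidef : ∀ z, (meas z).PosSemidef
  meas_sum : ∑ z, meas z = 1

/-- The overall interaction `W = U_{A A_p} ⊗ V_{B B_p}` of the two controlled unitaries
`U_{A A_p} = 1 ⊗ |0⟩⟨0| + U_A ⊗ |1⟩⟨1|`, `V_{B B_p} = 1 ⊗ |0⟩⟨0| + V_B ⊗ |1⟩⟨1|`,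
with the tensor factors ordered as `(A B) (A_p B_p)`. -/
def interaction (U V : Matrix Qubit Qubit ℂ) :
    Matrix (TwoQubit × TwoQubit) (TwoQubit × TwoQubit) ℂ :=
  ((1 : Matrix Qubit Qubit ℂ) ⊗ₖ (1 : Matrix Qubit Qubit ℂ)) ⊗ₖ
      Matrix.single ((0, 0) : TwoQubit) ((0, 0) : TwoQubit) (1 : ℂ) +
    (U ⊗ₖ (1 : Matrix Qubit Qubit ℂ)) ⊗ₖ
      Matrix.single ((1, 0) : TwoQubit) ((1, 0) : TwoQubit) (1 : ℂ) +
    ((1 : Matrix Qubit Qubit ℂ) ⊗ₖ V) ⊗ₖ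
      Matrix.single ((0, 1) : TwoQubit) ((0, 1) : TwoQubit) (1 : ℂ) +
    (U ⊗ₖ V) ⊗ₖ
      Matrix.single ((1, 1) : TwoQubit) ((1, 1) : TwoQubit) (1 : ℂ)

/-- The winning probability
`∑_z (1/2) Tr[(Π^(z) ⊗ |z⟩⟨z|) W (ρ ⊗ |z⟩⟨z|) W†]` of a tactic with shared state `ρ`. -/
def bdWinProb (ρ : Matrix TwoQubit TwoQubit ℂ) (t : BDTactic) : ℝ :=
  ∑ z : Fin 2, (1 / 2 : ℝ) *
    (((t.meas z) ⊗ₖ ketbra (question z)) *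
      interaction t.U t.V * (ρ ⊗ₖ ketbra (question z)) * (interaction t.U t.V)ᴴ).trace.re

/-- The state `ρ` allows a winning probability above the classical value `1/2`. -/
def BDNonClassical (ρ : Matrix TwoQubit TwoQubit ℂ) : Prop :=
  ∃ t : BDTactic, 1 / 2 < bdWinProb ρ t

/-! ### Teleportation of a qubit -/

/-- A vector of two qubits is maximally entangled (and then of unit norm) when its reduced
density matrix is `1/2` times the identity. -/
def IsMaxEntangled (ψ : TwoQubit → ℂ) : Prop :=
  ∀ a a' : Qubit, ∑ b, ψ (a, b) * star (ψ (a', b)) = if a = a' then 1 / 2 else 0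

/-- A standard teleportation protocol: Alice measures the input qubit together with her half `A`
of the shared state in an orthonormal basis of maximally entangled vectors, tells Bob the
outcome `k`, and Bob applies the unitary `U_k` to his half `B`. -/
structure TeleportationProtocol where
  basis : OrthonormalBasis (Fin 4) ℂ (EuclideanSpace ℂ TwoQubit)
  basis_maxEntangled : ∀ k, IsMaxEntangled (fun p => basis k p)
  correction : Fin 4 → Matrix.unitaryGroup Qubit ℂ

/-- Bob's unnormalised state
`Tr_{in,A}[(|Ψ_k⟩⟨Ψ_k| ⊗ 1_B) (|φ⟩⟨φ|_in ⊗ ρ_AB)]` after Alice's outcome `k`;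
its trace is the probability of that outcome. -/
def TeleportationProtocol.bobState (T : TeleportationProtocol)
    (ρ : Matrix TwoQubit TwoQubit ℂ) (φ : Qubit → ℂ) (k : Fin 4) : Matrix Qubit Qubit ℂ :=
  Matrix.of fun b b' => ∑ p : TwoQubit, ∑ p' : TwoQubit,
    star (T.basis k p) * (ketbra φ ⊗ₖ ρ) (p.1, (p.2, b)) (p'.1, (p'.2, b')) * T.basis k p'

/-- The state Bob ends up with, averaged over the outcomes: `∑_k U_k τ_k U_k†`. -/
def TeleportationProtocol.output (T : TeleportationProtocol)
    (ρ : Matrix TwoQubit TwoQubit ℂ) (φ : Qubit → ℂ) : Matrix Qubit Qubit ℂ :=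
  ∑ k, (T.correction k : Matrix Qubit Qubit ℂ) * T.bobState ρ φ k *
    (T.correction k : Matrix Qubit Qubit ℂ)ᴴ

/-- The pure qubit state `cos(θ/2)|0⟩ + e^{iα} sin(θ/2)|1⟩` with Bloch angles `θ`, `α`. -/
def blochKet (θ α : ℝ) : Qubit → ℂ :=
  ![(Real.cos (θ / 2) : ℂ), Complex.exp (α * Complex.I) * (Real.sin (θ / 2) : ℂ)]

/-- The teleportation fidelity: the average of `⟨φ| output(φ) |φ⟩` over all pure input states,
uniformly distributed on the Bloch sphere. -/
def TeleportationProtocol.fidelity (T : TeleportationProtocol)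
    (ρ : Matrix TwoQubit TwoQubit ℂ) : ℝ :=
  1 / (4 * Real.pi) * ∫ θ in (0 : ℝ)..Real.pi, ∫ α in (0 : ℝ)..(2 * Real.pi),
    (star (blochKet θ α) ⬝ᵥ (T.output ρ (blochKet θ α) *ᵥ blochKet θ α)).re * Real.sin θ

/-- The state `ρ` allows a teleportation fidelity above `2/3`, the best average fidelity that is
possible without entanglement. -/
def TeleportationNonClassical (ρ : Matrix TwoQubit TwoQubit ℂ) : Prop :=
  ∃ T : TeleportationProtocol, 2 / 3 < T.fidelity ρ

end

/-! Both tasks are governed by overlaps `⟨χ|ρ|χ⟩` with maximally entangled `χ`. Averaging over the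
Bloch sphere gives `f = 1/3 + (1/6) ∑ₖ ⟨χₖ|ρ|χₖ⟩`, where `χₖ` is Alice's vector `Ψₖ` twisted by
Bob's correction (`fidelity_eq`). So `f > 2/3` forces some `⟨χₖ|ρ|χₖ⟩ > 1/2`.

Conversely, any maximally entangled `χ` yields a tactic that wins with probability exactly `⟨χ|ρ|χ⟩`
(`bdWinProb_tactic`). Take `U = σ_z` and `V` with `(σ_z ⊗ V) χ = χ`. Projecting the question qubits
back onto `z` applies `(1 + σ_z ⊗ V)/2` to `AB` for `Φ⁺` and `(σ_z ⊗ 1 + 1 ⊗ V)/2` for `Ψ⁺`. The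
former fixes `χ`, the latter sends it to the orthogonal vector `(σ_z ⊗ 1) χ`, so testing for `χ`
tells the questions apart. -/

lemma IsMaxEntangled.sum_star_mul {ψ : TwoQubit → ℂ} (h : IsMaxEntangled ψ) (b b' : Qubit) :
    ∑ a, star (ψ (a, b)) * ψ (a, b') = if b = b' then 1 / 2 else 0 := by
  let M : Matrix Qubit Qubit ℂ := Matrix.of fun a b => ψ (a, b)
  -- A right inverse of a square matrix is a left inverse, so the reduced state of the other qubit
  -- is maximally mixed too.
  have h1 : M * ((2 : ℂ) • Mᴴ) = 1 := by
    ext a a'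
    have := h a a'
    rw [Matrix.mul_smul, Matrix.smul_apply, Matrix.mul_apply, Matrix.one_apply]
    simp only [M, Matrix.conjTranspose_apply, Matrix.of_apply, this]
    split_ifs <;> simp
  have h2 : (((2 : ℂ) • Mᴴ) * M) b b' = (1 : Matrix Qubit Qubit ℂ) b b' := by
    rw [mul_eq_one_comm.mp h1]
  simp only [M, Matrix.mul_apply, Matrix.smul_apply, Matrix.conjTranspose_apply,
    Matrix.of_apply, Matrix.one_apply, smul_eq_mul] at h2
  simp only [mul_assoc, ← Finset.mul_sum] at h2
  split_ifs at h2 ⊢ <;> linear_combination h2 / 2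

/-! ### The Bell-distinguishing game -/

/-- The operators that the interaction applies to `AB`, by the basis state of `A_p B_p`. -/
def controlled (U V : Matrix Qubit Qubit ℂ) (q : TwoQubit) : Matrix TwoQubit TwoQubit ℂ :=
  (if q.1 = 0 then 1 else U) ⊗ₖ (if q.2 = 0 then 1 else V)

lemma interaction_eq_sum (U V : Matrix Qubit Qubit ℂ) :
    interaction U V = ∑ q, controlled U V q ⊗ₖ Matrix.single q q (1 : ℂ) := by
  simp [interaction, controlled, Fintype.sum_prod_type]
  abel

/-- The operator `⟨z| W |z⟩` on `AB`. -/
def kraus (U V : Matrix Qubit Qubit ℂ) (z : TwoQubit → ℂ) : Matrix TwoQubit TwoQubit ℂ :=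
  ∑ q, (z q * star (z q)) • controlled U V q

lemma trace_ketbra_single (z : TwoQubit → ℂ) (q r : TwoQubit) :
    (ketbra z * Matrix.single q q (1 : ℂ) * ketbra z * Matrix.single r r (1 : ℂ)).trace =
      (z q * star (z q)) * (z r * star (z r)) := by
  rw [Matrix.trace_mul_single]
  simp [Matrix.mul_apply, Matrix.single_apply, ketbra, Matrix.vecMulVec_apply, ite_and]
  ring

/-- The interaction is diagonal in the control basis and `|z⟩⟨z|` has rank one, so the double sum
over control values factorises and a single Kraus operator remains. -/
lemma trace_interaction (P ρ : Matrix TwoQubit TwoQubit ℂ) (U V : Matrix Qubit Qubit ℂ)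
    (z : TwoQubit → ℂ) :
    ((P ⊗ₖ ketbra z) * interaction U V * (ρ ⊗ₖ ketbra z) * (interaction U V)ᴴ).trace =
      (P * kraus U V z * ρ * (kraus U V z)ᴴ).trace := by
  simp only [interaction_eq_sum, kraus, Matrix.conjTranspose_sum, Finset.mul_sum, Finset.sum_mul,
    Matrix.trace_sum, Matrix.conjTranspose_kronecker, ← Matrix.mul_kronecker_mul,
    Matrix.trace_kronecker, Matrix.conjTranspose_single, star_one, trace_ketbra_single,
    Matrix.conjTranspose_smul, Matrix.mul_smul, Matrix.smul_mul, Matrix.trace_smul, smul_eq_mul]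
  refine Finset.sum_congr rfl fun q _ => Finset.sum_congr rfl fun r _ => ?_
  simp only [star_mul', star_star]
  ring

lemma bellPhi_mul_star (q : TwoQubit) :
    bellPhi q * star (bellPhi q) = if q.1 = q.2 then 1 / 2 else 0 := by
  unfold bellPhi
  split_ifs
  · rw [Complex.star_def, Complex.conj_ofReal, ← Complex.ofReal_mul, ← mul_div_mul_comm]
    simp
  · simp

lemma bellPsi_mul_star (q : TwoQubit) :
    bellPsi q * star (bellPsi q) = if q.1 = q.2 then 0 else 1 / 2 := by
  unfold bellPsi
  split_ifs
  · simp
  · rw [Complex.star_def, Complex.conj_ofReal, ← Complex.ofReal_mul, ← mul_div_mul_comm]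
    simp

/-- The unitary `σ_z`. -/
def pauliZ : Matrix Qubit Qubit ℂ := Matrix.diagonal ![1, -1]

/-- The reflection `V` with `(σ_z ⊗ V) χ = χ` for a maximally entangled `χ`. -/
def reflection (χ : TwoQubit → ℂ) : Matrix Qubit Qubit ℂ :=
  Matrix.of fun b b' => 2 * (χ (0, b) * star (χ (0, b')) - χ (1, b) * star (χ (1, b')))

/-- The vector `(σ_z ⊗ 1) χ`. -/
def phaseFlip (χ : TwoQubit → ℂ) : TwoQubit → ℂ := fun p => (if p.1 = 0 then 1 else -1) * χ p

lemma pauliZ_mem_unitaryGroup : pauliZ ∈ Matrix.unitaryGroup Qubit ℂ := by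
  rw [Matrix.mem_unitaryGroup_iff]
  ext i j
  fin_cases i <;> fin_cases j <;> simp [pauliZ, Matrix.star_eq_conjTranspose, Matrix.mul_apply]

/-- The rows of `√2 χ` form an orthonormal basis, on which `V` acts with eigenvalues `1` and `-1`.
-/
lemma IsMaxEntangled.reflection_mem_unitaryGroup {χ : TwoQubit → ℂ} (h : IsMaxEntangled χ) :
    reflection χ ∈ Matrix.unitaryGroup Qubit ℂ := by
  rw [Matrix.mem_unitaryGroup_iff]
  have h00 := h 0 0
  have h01 := h 0 1
  have h10 := h 1 0
  have h11 := h 1 1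
  ext b b'
  have hb := h.sum_star_mul b' b
  simp only [Fin.sum_univ_two, reflection, Matrix.star_eq_conjTranspose, Matrix.mul_apply,
    Matrix.conjTranspose_apply, Matrix.of_apply, Matrix.one_apply, star_mul', star_sub, Complex.conj_conj,
    eq_comm (a := b') (b := b), Complex.star_def, map_ofNat] at *
  rw [show (if b = b' then (1 : ℂ) else 0) = 2 * (if b = b' then 1 / 2 else 0) by
    split_ifs <;> norm_num, ← hb]
  simp at h00 h01 h10 h11
  linear_combination (4 * χ (0, b) * (starRingEnd ℂ) (χ (0, b'))) * h00
    + (4 * χ (1, b) * (starRingEnd ℂ) (χ (1, b'))) * h11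
    - (4 * χ (0, b) * (starRingEnd ℂ) (χ (1, b'))) * h10
    - (4 * χ (1, b) * (starRingEnd ℂ) (χ (0, b'))) * h01

/-- Here the Kraus operator is `(1 + σ_z ⊗ V)/2`, the projection onto the `+1` eigenspace of `σ_z ⊗
V`, which `χ` and `(σ_z ⊗ 1) χ` span. -/
lemma IsMaxEntangled.kraus_bellPhi {χ : TwoQubit → ℂ} (h : IsMaxEntangled χ) :
    kraus pauliZ (reflection χ) bellPhi =
      ketbra χ + ketbra (phaseFlip χ) := by
  ext ⟨a, b⟩ ⟨a', b'⟩
  have hb := h.sum_star_mul b' b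
  -- Completeness of the rows of `χ` turns the identity on `B` into a polynomial in the entries of
  -- `χ`.
  have h1 : (if b = b' then 1 else 0) = 2 * ∑ x, star (χ (x, b')) * χ (x, b) := by
    rw [hb]; simp only [eq_comm (a := b') (b := b)]; split_ifs <;> norm_num
  simp only [kraus, bellPhi_mul_star, Fintype.sum_prod_type, Fin.sum_univ_two] at *
  fin_cases a <;> fin_cases a' <;>
    simp [controlled, pauliZ, reflection, ketbra, Matrix.vecMulVec_apply, phaseFlip,
      Matrix.one_apply, h1] <;> ring

/-- This operator is `σ_z ⊗ 1` times the projection for `Φ⁺`, hence swaps `χ` and `(σ_z ⊗ 1) χ`. -/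
lemma IsMaxEntangled.kraus_bellPsi {χ : TwoQubit → ℂ} (h : IsMaxEntangled χ) :
    kraus pauliZ (reflection χ) bellPsi =
      Matrix.vecMulVec (phaseFlip χ) (star χ) + Matrix.vecMulVec χ (star (phaseFlip χ)) := by
  ext ⟨a, b⟩ ⟨a', b'⟩
  have hb := h.sum_star_mul b' b
  have h1 : (if b = b' then 1 else 0) = 2 * ∑ x, star (χ (x, b')) * χ (x, b) := by
    rw [hb]; simp only [eq_comm (a := b') (b := b)]; split_ifs <;> norm_num
  simp only [kraus, bellPsi_mul_star, Fintype.sum_prod_type, Fin.sum_univ_two] at *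
  fin_cases a <;> fin_cases a' <;>
    simp [controlled, pauliZ, reflection, Matrix.vecMulVec_apply, phaseFlip,
      Matrix.one_apply, h1] <;> ring

lemma IsMaxEntangled.star_dotProduct_self {χ : TwoQubit → ℂ} (h : IsMaxEntangled χ) :
    star χ ⬝ᵥ χ = 1 := by
  have h0 := h 0 0
  have h1 := h 1 1
  simp [dotProduct, Fintype.sum_prod_type] at *
  linear_combination h0 + h1

lemma IsMaxEntangled.star_dotProduct_phaseFlip {χ : TwoQubit → ℂ} (h : IsMaxEntangled χ) :
    star χ ⬝ᵥ phaseFlip χ = 0 := by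
  have h0 := h 0 0
  have h1 := h 1 1
  simp [dotProduct, Fintype.sum_prod_type, phaseFlip] at *
  linear_combination h0 - h1

lemma IsMaxEntangled.star_phaseFlip_dotProduct {χ : TwoQubit → ℂ} (h : IsMaxEntangled χ) :
    star (phaseFlip χ) ⬝ᵥ χ = 0 := by
  have h0 := h 0 0
  have h1 := h 1 1
  simp [dotProduct, Fintype.sum_prod_type, phaseFlip] at *
  linear_combination h0 - h1

lemma IsMaxEntangled.star_phaseFlip_dotProduct_self {χ : TwoQubit → ℂ} (h : IsMaxEntangled χ) :
    star (phaseFlip χ) ⬝ᵥ phaseFlip χ = 1 := by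
  have h0 := h 0 0
  have h1 := h 1 1
  simp [dotProduct, Fintype.sum_prod_type, phaseFlip] at *
  linear_combination h0 + h1

lemma posSemidef_one_sub_ketbra {χ : TwoQubit → ℂ} (h : star χ ⬝ᵥ χ = 1) :
    (1 - ketbra χ).PosSemidef := by
  have hh : (ketbra χ)ᴴ = ketbra χ := by simp [ketbra, Matrix.conjTranspose_vecMulVec]
  have hi : ketbra χ * ketbra χ = ketbra χ := by
    simp [ketbra, Matrix.vecMulVec_mul_vecMulVec, h]
  have : 1 - ketbra χ = (1 - ketbra χ)ᴴ * (1 - ketbra χ) := by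
    rw [Matrix.conjTranspose_sub, hh, Matrix.conjTranspose_one]
    rw [mul_sub, sub_mul, sub_mul, hi]
    simp
  rw [this]
  exact Matrix.posSemidef_conjTranspose_mul_self _

/-- The tactic adapted to a maximally entangled vector. -/
def IsMaxEntangled.tactic {χ : TwoQubit → ℂ} (h : IsMaxEntangled χ) : BDTactic where
  U := ⟨pauliZ, pauliZ_mem_unitaryGroup⟩
  V := ⟨reflection χ, h.reflection_mem_unitaryGroup⟩
  meas := ![ketbra χ, 1 - ketbra χ]
  meas_posSemidef z := by
    fin_cases z
    · exact Matrix.posSemidef_vecMulVec_self_star χ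
    · exact posSemidef_one_sub_ketbra h.star_dotProduct_self
  meas_sum := by simp

/-- Followed by the correct measurement projection, each Kraus operator collapses to a rank one
operator with bra `⟨χ|`, so each question contributes half of the overlap. -/
lemma IsMaxEntangled.bdWinProb_tactic {χ : TwoQubit → ℂ} (h : IsMaxEntangled χ)
    (ρ : Matrix TwoQubit TwoQubit ℂ) :
    bdWinProb ρ h.tactic = (star χ ⬝ᵥ (ρ *ᵥ χ)).re := by
  have h1 := h.star_dotProduct_self
  have h2 := h.star_dotProduct_phaseFlip
  have h3 := h.star_phaseFlip_dotProduct
  have h4 := h.star_phaseFlip_dotProduct_self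
  have t0 : (ketbra χ * kraus pauliZ (reflection χ) bellPhi * ρ *
      (kraus pauliZ (reflection χ) bellPhi)ᴴ).trace = star χ ⬝ᵥ (ρ *ᵥ χ) := by
    have e : ketbra χ * kraus pauliZ (reflection χ) bellPhi = ketbra χ := by
      simp [h.kraus_bellPhi, ketbra, mul_add, Matrix.vecMulVec_mul_vecMulVec, h1, h2]
    rw [e, ketbra, Matrix.vecMulVec_mul, Matrix.vecMulVec_mul, Matrix.trace_vecMulVec,
      dotProduct_comm, ← Matrix.dotProduct_mulVec, ← Matrix.dotProduct_mulVec]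
    congr 2
    simp [h.kraus_bellPhi, ketbra, Matrix.add_mulVec, Matrix.conjTranspose_vecMulVec,
      Matrix.vecMulVec_mulVec, h1, h3]
  have t1 : ((1 - ketbra χ) * kraus pauliZ (reflection χ) bellPsi * ρ *
      (kraus pauliZ (reflection χ) bellPsi)ᴴ).trace = star χ ⬝ᵥ (ρ *ᵥ χ) := by
    have e : (1 - ketbra χ) * kraus pauliZ (reflection χ) bellPsi =
        Matrix.vecMulVec (phaseFlip χ) (star χ) := by
      simp [h.kraus_bellPsi, ketbra, mul_add, sub_mul, Matrix.vecMulVec_mul_vecMulVec, h1, h2]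
    rw [e, Matrix.vecMulVec_mul, Matrix.vecMulVec_mul, Matrix.trace_vecMulVec,
      dotProduct_comm, ← Matrix.dotProduct_mulVec, ← Matrix.dotProduct_mulVec]
    congr 2
    simp [h.kraus_bellPsi, Matrix.add_mulVec, Matrix.conjTranspose_vecMulVec,
      Matrix.vecMulVec_mulVec, h2, h4]
  simp only [bdWinProb, trace_interaction, Fin.sum_univ_two]
  simp only [IsMaxEntangled.tactic, question, Matrix.cons_val_zero, Matrix.cons_val_one, t0, t1]
  ring

/-! ### Fourth moments of the uniform distribution on the Bloch sphere -/

lemma integral_exp_int_mul_I (m : ℤ) :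
    ∫ α in (0 : ℝ)..(2 * Real.pi), Complex.exp (m * (α * Complex.I)) =
      if m = 0 then (2 * Real.pi : ℂ) else 0 := by
  split_ifs with hm
  · simp [hm]
  · have hc : (m : ℂ) * Complex.I ≠ 0 := by simp [hm]
    have h := integral_exp_mul_complex (a := 0) (b := 2 * Real.pi) hc
    have h2 : Complex.exp (m * Complex.I * (2 * Real.pi : ℝ)) = 1 := by
      rw [Complex.exp_eq_one_iff]
      exact ⟨m, by push_cast; ring⟩
    rw [h2] at h
    simp only [Complex.ofReal_zero, mul_zero, Complex.exp_zero, sub_self, zero_div] at h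
    rw [← h]
    congr 1
    ext α
    congr 1
    ring

/-- Substitution `x = cos²(θ/2)`, for which `dx = -(sin θ)/2 dθ`. -/
lemma integral_of_hasDerivAt_half_angle (P : ℝ → ℝ) (p : ℝ → ℝ)
    (hP : ∀ x, HasDerivAt P (p x) x) (hp : Continuous p) :
    ∫ θ in (0 : ℝ)..Real.pi, p (Real.cos (θ / 2) ^ 2) * Real.sin θ = 2 * (P 1 - P 0) := by
  have hd : ∀ θ ∈ Set.uIcc (0 : ℝ) Real.pi,
      HasDerivAt (fun θ : ℝ => -2 * P (Real.cos (θ / 2) ^ 2))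
        (p (Real.cos (θ / 2) ^ 2) * Real.sin θ) θ := by
    intro θ _
    have h1 : HasDerivAt (fun θ : ℝ => Real.cos (θ / 2) ^ 2)
        (-(Real.sin θ) / 2) θ := by
      have := (((hasDerivAt_id θ).div_const 2).cos).pow 2
      refine this.congr_deriv ?_
      have h2 : Real.sin θ = 2 * Real.sin (θ / 2) * Real.cos (θ / 2) := by
        rw [← Real.sin_two_mul]; congr 1; ring
      rw [h2]; simp; ring
    refine (((hP _).comp θ h1).const_mul (-2)).congr_deriv ?_
    ring
  rw [intervalIntegral.integral_eq_sub_of_hasDerivAt hd]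
  · simp; ring
  · apply Continuous.intervalIntegrable
    fun_prop

/-- After division by the area `4π`, this is the average of `|φφ⟩⟨φφ|`: the projection onto the
three-dimensional symmetric subspace divided by `3`, that is, (identity + swap)/6. -/
lemma integral_blochKet_moment (i j k l : Qubit) :
    ∫ θ in (0 : ℝ)..Real.pi, ∫ α in (0 : ℝ)..(2 * Real.pi),
      blochKet θ α i * star (blochKet θ α j) * star (blochKet θ α k) * blochKet θ α l *
        (Real.sin θ : ℂ) =
      (4 * Real.pi) / 6 * ((if i = j ∧ k = l then 1 else 0) + (if i = k ∧ j = l then 1 else 0)) := by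
  -- The number of indices equal to `1` is at most `4`, so the natural subtraction in the exponent
  -- is exact.
  have key : ∀ θ α : ℝ, blochKet θ α i * star (blochKet θ α j) * star (blochKet θ α k) *
      blochKet θ α l * (Real.sin θ : ℂ) =
      ((Real.cos (θ / 2) ^ (4 - (i.val + j + k + l)) * Real.sin (θ / 2) ^ (i.val + j + k + l)
        * Real.sin θ : ℝ) : ℂ) *
        Complex.exp (((i.val : ℤ) - j - k + l : ℤ) * (α * Complex.I)) := by
    intro θ α
    have hs : (starRingEnd ℂ) (Complex.exp (α * Complex.I)) = (Complex.exp (α * Complex.I))⁻¹ := by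
      rw [← Complex.exp_conj, ← Complex.exp_neg]; simp
    rw [Complex.exp_int_mul]
    unfold blochKet
    have hne := Complex.exp_ne_zero (α * Complex.I)
    generalize Complex.exp (α * Complex.I) = e at *
    fin_cases i <;> fin_cases j <;> fin_cases k <;> fin_cases l <;>
      simp [-Complex.ofReal_cos, -Complex.ofReal_sin, hs] <;> field_simp <;> simp
  simp only [key, intervalIntegral.integral_const_mul, integral_exp_int_mul_I]
  rw [intervalIntegral.integral_mul_const]
  rw [intervalIntegral.integral_ofReal]
  have hsin : ∀ θ : ℝ, Real.sin (θ / 2) ^ 2 = 1 - Real.cos (θ / 2) ^ 2 := fun θ => by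
    linarith [Real.sin_sq_add_cos_sq (θ / 2)]
  -- The phase integral vanishes unless `i + l = j + k`, which leaves only `0`, `2` or `4` factors
  -- of sine.
  have e0 : ∫ θ in (0 : ℝ)..Real.pi, Real.cos (θ / 2) ^ 4 * Real.sin θ = 2 / 3 := by
    have := integral_of_hasDerivAt_half_angle (fun x => x ^ 3 / 3) (fun x => x ^ 2)
      (fun x => ((hasDerivAt_pow 3 x).div_const 3).congr_deriv (by norm_num)) (by fun_prop)
    simp only [← pow_mul] at this
    norm_num at this ⊢
    exact this
  have e2 : ∫ θ in (0 : ℝ)..Real.pi, Real.cos (θ / 2) ^ 2 * Real.sin (θ / 2) ^ 2 * Real.sin θ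
      = 1 / 3 := by
    have := integral_of_hasDerivAt_half_angle (fun x => x ^ 2 / 2 - x ^ 3 / 3)
      (fun x => x * (1 - x))
      (fun x => (((hasDerivAt_pow 2 x).div_const 2).sub
        ((hasDerivAt_pow 3 x).div_const 3)).congr_deriv (by norm_num; ring)) (by fun_prop)
    simp only [hsin, this]
    norm_num
  have e4 : ∫ θ in (0 : ℝ)..Real.pi, Real.sin (θ / 2) ^ 4 * Real.sin θ = 2 / 3 := by
    have := integral_of_hasDerivAt_half_angle (fun x => x - x ^ 2 + x ^ 3 / 3)
      (fun x => (1 - x) ^ 2)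
      (fun x => (((hasDerivAt_id x).sub (hasDerivAt_pow 2 x)).add
        ((hasDerivAt_pow 3 x).div_const 3)).congr_deriv (by norm_num; ring)) (by fun_prop)
    simp only [← hsin, ← pow_mul] at this
    norm_num at this ⊢
    exact this
  fin_cases i <;> fin_cases j <;> fin_cases k <;> fin_cases l <;>
      simp [e0, e2, e4] <;> ring

lemma continuous_blochKet (i : Qubit) : Continuous fun x : ℝ × ℝ => blochKet x.1 x.2 i := by
  fin_cases i <;> simp [blochKet] <;> fun_prop

/-- The average over the Bloch sphere of a quartic form in the amplitudes. -/
lemma integral_blochKet_quartic (C : Qubit → Qubit → Qubit → Qubit → ℂ) :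
    1 / (4 * Real.pi) * ∫ θ in (0 : ℝ)..Real.pi, ∫ α in (0 : ℝ)..(2 * Real.pi),
      (∑ i, ∑ j, ∑ k, ∑ l, C i j k l * (blochKet θ α i * star (blochKet θ α j) *
        star (blochKet θ α k) * blochKet θ α l)).re * Real.sin θ =
      1 / 6 * (∑ i, ∑ k, C i i k k + ∑ i, ∑ j, C i j i j).re := by
  have hc : ∀ i j k l, Continuous fun x : ℝ × ℝ => blochKet x.1 x.2 i *
      star (blochKet x.1 x.2 j) * star (blochKet x.1 x.2 k) * blochKet x.1 x.2 l *
        (Real.sin x.1 : ℂ) := fun i j k l => by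
    have := continuous_blochKet
    fun_prop
  let F : Qubit × Qubit × Qubit × Qubit → ℝ → ℝ → ℂ := fun q θ α =>
    blochKet θ α q.1 * star (blochKet θ α q.2.1) * star (blochKet θ α q.2.2.1) *
      blochKet θ α q.2.2.2 * (Real.sin θ : ℂ)
  let c : Qubit × Qubit × Qubit × Qubit → ℂ := fun q => C q.1 q.2.1 q.2.2.1 q.2.2.2
  have hF : ∀ q, Continuous (Function.uncurry (F q)) := fun q => hc _ _ _ _
  have hFα : ∀ q θ, Continuous (F q θ) := fun q θ => (hF q).uncurry_left θ
  have hFθ : ∀ q, Continuous fun θ => ∫ α in (0 : ℝ)..(2 * Real.pi), F q θ α := fun q =>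
    intervalIntegral.continuous_parametric_intervalIntegral_of_continuous' (hF q) _ _
  have hpt : ∀ θ α, (∑ i, ∑ j, ∑ k, ∑ l, C i j k l * (blochKet θ α i * star (blochKet θ α j) *
        star (blochKet θ α k) * blochKet θ α l)).re * Real.sin θ = (∑ q, c q * F q θ α).re := by
    intro θ α
    rw [← Complex.re_mul_ofReal]
    simp only [F, c, Fintype.sum_prod_type, Finset.sum_mul, mul_assoc]
  -- Used twice: for the inner integral over `α` and for the outer one over `θ`.
  have hlin : ∀ (G : Qubit × Qubit × Qubit × Qubit → ℝ → ℂ) (a b : ℝ), (∀ q, Continuous (G q)) →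
      ∫ x in a..b, (∑ q, c q * G q x).re = (∑ q, c q * ∫ x in a..b, G q x).re := by
    intro G a b hG
    have hcont : ∀ q, Continuous fun x => c q * G q x := fun q => continuous_const.mul (hG q)
    have hre := Complex.reCLM.intervalIntegral_comp_comm
      ((continuous_finsetSum Finset.univ fun q _ => hcont q).intervalIntegrable
        (μ := MeasureTheory.volume) a b)
    simp only [Complex.reCLM_apply] at hre
    rw [hre, intervalIntegral.integral_finsetSum fun q _ => (hcont q).intervalIntegrable _ _]
    simp only [intervalIntegral.integral_const_mul]
  simp only [hpt]
  simp only [hlin _ _ _ fun q => hFα q _]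
  rw [hlin (fun q θ => ∫ α in (0 : ℝ)..(2 * Real.pi), F q θ α) _ _ hFθ]
  simp only [F, integral_blochKet_moment, c]
  rw [← Complex.re_ofReal_mul, ← Complex.re_ofReal_mul]
  congr 1
  have hpi : (Real.pi : ℂ) ≠ 0 := by exact_mod_cast Real.pi_ne_zero
  simp [Fintype.sum_prod_type]
  field_simp
  ring

/-! ### Teleportation -/

namespace TeleportationProtocol

variable (T : TeleportationProtocol) (ρ : Matrix TwoQubit TwoQubit ℂ)

/-- The vector of `AB` onto which a shared state is projected when the input amplitude is `i`, the
outcome is `k`, and the output amplitude is `c`. -/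
noncomputable def branch (k : Fin 4) (i c : Qubit) : TwoQubit → ℂ := fun p =>
  T.basis k (i, p.1) * star ((T.correction k : Matrix Qubit Qubit ℂ) c p.2)

/-- The maximally entangled vector of `AB` that outcome `k` singles out. -/
noncomputable def resource (k : Fin 4) : TwoQubit → ℂ := ∑ i, T.branch k i i

/-- As a matrix, the resource is the transpose of `Ψₖ` times the entrywise conjugate of `Uₖ`; both
are unitary up to the scalar that `Ψₖ` carries. -/
lemma isMaxEntangled_resource (k : Fin 4) : IsMaxEntangled (T.resource k) := by
  intro a a'
  have hU : ∀ i j, ∑ b, star ((T.correction k : Matrix Qubit Qubit ℂ) i b) *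
      (T.correction k : Matrix Qubit Qubit ℂ) j b = if j = i then 1 else 0 := by
    intro i j
    have := congrFun (congrFun (Matrix.mem_unitaryGroup_iff.mp (T.correction k).2) j) i
    simp only [Matrix.star_eq_conjTranspose, Matrix.mul_apply, Matrix.conjTranspose_apply,
      Matrix.one_apply] at this
    rw [← this]
    exact Finset.sum_congr rfl fun b _ => mul_comm _ _
  have hψ := (T.basis_maxEntangled k).sum_star_mul a' a
  calc ∑ b, T.resource k (a, b) * star (T.resource k (a', b))
      = ∑ i, ∑ j, (T.basis k (i, a) * star (T.basis k (j, a'))) *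
          ∑ b, star ((T.correction k : Matrix Qubit Qubit ℂ) i b) *
            (T.correction k : Matrix Qubit Qubit ℂ) j b := by
        simp [resource, branch, Fin.sum_univ_two]
        ring
    _ = _ := by
        simp only [hU]
        simp only [mul_ite, mul_one, mul_zero, Finset.sum_ite_eq', Finset.mem_univ, if_true]
        rw [Finset.sum_congr rfl fun i _ => mul_comm _ _, hψ]
        simp only [eq_comm]

/-- Fixing the input, the outcome and Bob's test vector `y` projects `AB` onto one product vector
`v`. -/
lemma star_dotProduct_bobState (k : Fin 4) (φ y : Qubit → ℂ) (v : TwoQubit → ℂ)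
    (hv : ∀ p, v p = (∑ i, T.basis k (i, p.1) * star (φ i)) * y p.2) :
    star y ⬝ᵥ (T.bobState ρ φ k *ᵥ y) = star v ⬝ᵥ (ρ *ᵥ v) := by
  simp [dotProduct, Matrix.mulVec, bobState, hv, Fintype.sum_prod_type, ketbra,
    Matrix.vecMulVec_apply]
  ring

lemma star_dotProduct_correction (k : Fin 4) (φ : Qubit → ℂ) :
    star φ ⬝ᵥ (((T.correction k : Matrix Qubit Qubit ℂ) * T.bobState ρ φ k *
      (T.correction k : Matrix Qubit Qubit ℂ)ᴴ) *ᵥ φ) = ∑ i, ∑ j, ∑ c, ∑ d,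
      (star (T.branch k i c) ⬝ᵥ (ρ *ᵥ T.branch k j d)) *
        (φ i * star (φ j) * star (φ c) * φ d) := by
  let U : Matrix Qubit Qubit ℂ := T.correction k
  -- Bob's test vector is `Uₖ† φ`; expanding `v` in the amplitudes of `φ` makes the overlap a
  -- quartic form.
  let v : TwoQubit → ℂ := ∑ i, ∑ c, (star (φ i) * φ c) • T.branch k i c
  have h1 : star φ ⬝ᵥ ((U * T.bobState ρ φ k * Uᴴ) *ᵥ φ) =
      star (Uᴴ *ᵥ φ) ⬝ᵥ (T.bobState ρ φ k *ᵥ (Uᴴ *ᵥ φ)) := by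
    rw [Matrix.star_mulVec, Matrix.conjTranspose_conjTranspose, ← Matrix.dotProduct_mulVec,
      Matrix.mulVec_mulVec, Matrix.mulVec_mulVec]
  have h2 := T.star_dotProduct_bobState ρ k φ (Uᴴ *ᵥ φ) v fun p => by
    simp [v, U, branch, Matrix.mulVec, dotProduct]
    ring
  rw [h1, h2]
  simp only [v, star_sum, star_smul, Matrix.mulVec_sum, Matrix.mulVec_smul, sum_dotProduct,
    dotProduct_sum, smul_dotProduct, dotProduct_smul, smul_eq_mul, star_mul', star_star]
  simp only [Fin.sum_univ_two]
  ring

lemma star_dotProduct_output (φ : Qubit → ℂ) :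
    star φ ⬝ᵥ (T.output ρ φ *ᵥ φ) = ∑ i, ∑ j, ∑ c, ∑ d,
      (∑ k, star (T.branch k i c) ⬝ᵥ (ρ *ᵥ T.branch k j d)) *
        (φ i * star (φ j) * star (φ c) * φ d) := by
  simp only [output, Matrix.sum_mulVec, dotProduct_sum, star_dotProduct_correction,
    Finset.sum_mul]
  simp only [Finset.sum_comm (s := Finset.univ (α := Qubit)) (t := Finset.univ (α := Fin 4))]

/-- The projectors onto the branches sum to half the identity: `Ψₖ` supplies the factor `1/2` on
`A`, unitarity of `Uₖ` the identity on `B`. -/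
lemma sum_branch (k : Fin 4) :
    ∑ i, ∑ c, star (T.branch k i c) ⬝ᵥ (ρ *ᵥ T.branch k i c) = 1 / 2 * ρ.trace := by
  have hU : ∀ b b', ∑ c, (T.correction k : Matrix Qubit Qubit ℂ) c b *
      star ((T.correction k : Matrix Qubit Qubit ℂ) c b') = if b' = b then 1 else 0 := by
    intro b b'
    have := congrFun (congrFun (Matrix.mem_unitaryGroup_iff'.mp (T.correction k).2) b') b
    simp only [Matrix.star_eq_conjTranspose, Matrix.mul_apply, Matrix.conjTranspose_apply,
      Matrix.one_apply] at this
    rw [← this]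
    exact Finset.sum_congr rfl fun b _ => mul_comm _ _
  calc ∑ i, ∑ c, star (T.branch k i c) ⬝ᵥ (ρ *ᵥ T.branch k i c)
      = ∑ p, ∑ p', ρ p p' * (∑ i, star (T.basis k (i, p.1)) * T.basis k (i, p'.1)) *
          ∑ c, (T.correction k : Matrix Qubit Qubit ℂ) c p.2 *
            star ((T.correction k : Matrix Qubit Qubit ℂ) c p'.2) := by
        simp [branch, dotProduct, Matrix.mulVec, Fintype.sum_prod_type]
        ring
    _ = _ := by
        simp only [(T.basis_maxEntangled k).sum_star_mul, hU]
        simp [Fintype.sum_prod_type, Matrix.trace]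
        ring

/-- Of the two index pairings in the fourth moment, one gives `sum_branch`, in total `4 · 1/2 = 2`,
and the other assembles the branches into the resource vectors. -/
lemma fidelity_eq (hρ : ρ.trace = 1) :
    T.fidelity ρ = 1 / 3 + 1 / 6 * ∑ k, (star (T.resource k) ⬝ᵥ (ρ *ᵥ T.resource k)).re := by
  have h1 : ∑ i, ∑ c, ∑ k, star (T.branch k i c) ⬝ᵥ (ρ *ᵥ T.branch k i c) = 2 := by
    simp_rw [Finset.sum_comm (s := Finset.univ (α := Qubit)) (t := Finset.univ (α := Fin 4)),
      sum_branch, hρ]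
    norm_num
  have h2 : ∑ i, ∑ j, ∑ k, star (T.branch k i i) ⬝ᵥ (ρ *ᵥ T.branch k j j) =
      ∑ k, star (T.resource k) ⬝ᵥ (ρ *ᵥ T.resource k) := by
    simp_rw [Finset.sum_comm (s := Finset.univ (α := Qubit)) (t := Finset.univ (α := Fin 4)),
      resource, star_sum, Matrix.mulVec_sum, sum_dotProduct, dotProduct_sum]
  rw [fidelity]
  simp_rw [star_dotProduct_output]
  rw [integral_blochKet_quartic, h1, h2, Complex.add_re, Complex.re_sum]
  norm_num
  ring

end TeleportationProtocol

theorem mainTheorem7 (ρ : Matrix TwoQubit TwoQubit ℂ) (hρ : IsTwoQubitState ρ)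
    (htel : TeleportationNonClassical ρ) : BDNonClassical ρ := by
  obtain ⟨T, hT⟩ := htel
  rw [T.fidelity_eq ρ hρ.trace_eq_one] at hT
  -- The four overlaps total more than `2`, so one of them exceeds `1/2`.
  obtain ⟨k, hk⟩ : ∃ k, 1 / 2 < (star (T.resource k) ⬝ᵥ (ρ *ᵥ T.resource k)).re := by
    by_contra! h
    have := Finset.sum_le_sum fun k (_ : k ∈ Finset.univ) => h k
    simp only [Finset.sum_const, Finset.card_univ, Fintype.card_fin, nsmul_eq_mul] at this
    norm_num at this
    linarith
  exact ⟨(T.isMaxEntangled_resource k).tactic, by rwa [IsMaxEntangled.bdWinProb_tactic]⟩
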